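/- **Notation.** Let $\mathbb K=\mathbb R$ or $\mathbb C$. For a matrix $A$ over $\mathbb K$ let $A^T$, $A^H$, $\overline A$ denote its transpose, conjugate transpose and entrywise conjugate, $A^\dagger$ its Moore–Penrose pseudoinverse, $\|A\|_F$ its Frobenius norm and $\|A\|_2$ its spectral norm. For a positive semidefinite matrix $M$, $M^{1/2}$ is its positive semidefinite square root and $M^{-1/2}$ denotes $(M^{1/2})^{-1}$, with the inverse replaced by the pseudoinverse $(M^{1/2})^\dagger$ when $M$ is singular. Let $\mathsf{sym}$, $\mathsf{skew\text{-}sym}$, $\mathsf{Herm}$ be the sets of $A\in\mathbb K^{n\times n}$ with $A^T=A$, $A^T=-A$, $A^H=A$, respectively. For $\mathbb S\subseteq\mathbb K^{n\times n}$ and $X,B\in\mathbb K^{n\times p}$ put $$\mathbb S(X,B)=\{A\in\mathbb S: AX=B\},\qquad \sigma^{\mathbb S}(X,B)=\inf\{\|A\|:A\in\mathbb S(X,B)\},$$ where $\|\cdot\|$ is the norm under consideration, and let $\sigma^{\rm unstruc}(X,B)$ be $\sigma^{\mathbb S}(X,B)$ for $\mathbb S=\mathbb K^{n\times n}$. Define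 $$\mathcal F(X,B)=\begin{cases} BX^\dagger+(BX^\dagger)^T-(X^\dagger)^TX^TBX^\dagger, & \mathbb S=\mathsf{sym},\\ BX^\dagger-(BX^\dagger)^T-(X^\dagger)^TX^TBX^\dagger, & \mathbb S=\mathsf{skew\text{-}sym},\\ BX^\dagger+(BX^\dagger)^H-(X^\dagger)^HX^HBX^\dagger, & \mathbb S=\mathsf{Herm}.\end{cases}$$ **Theorem.** Let $X,B\in\mathbb K^{n\times p}$, let $\mathbb S\in\{\mathsf{sym},\mathsf{skew\text{-}sym},\mathsf{Herm}\}$ and suppose $\mathbb S(X,B)\neq\emptyset$. Then $A\in\mathbb S(X,B)$ if and only if, for some $Z\in\mathbb S$, $$A=\begin{cases}\mathcal F(X,B)+(I-XX^\dagger)^TZ(I-XX^\dagger), & \mathbb S\in\{\mathsf{sym},\mathsf{skew\text{-}sym}\},\\ \mathcal F(X,B)+(I-XX^\dagger)Z(I-XX^\dagger), & \mathbb S=\mathsf{Herm}.\end{cases}$$ (a) *Frobenius norm.* $A_o:=\mathcal F(X,B)$ is the unique matrix in $\mathbb S(X,B)$ with $\|A_o\|_F=\sigma^{\mathbb S}(X,B)$,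 and $$\sigma^{\mathbb S}(X,B)=\|A_o\|_F=\begin{cases}\sqrt{2\|BX^\dagger\|_F^2-\mathrm{Tr}\big(BX^\dagger(BX^\dagger)^H(XX^\dagger)^T\big)}, & \mathbb S\in\{\mathsf{sym},\mathsf{skew\text{-}sym}\},\\ \sqrt{2\|BX^\dagger\|_F^2-\mathrm{Tr}\big(BX^\dagger(BX^\dagger)^HXX^\dagger\big)}, & \mathbb S=\mathsf{Herm}\end{cases}$$ (the trace is real and the radicand nonnegative). (b) *Spectral norm.* $\sigma^{\mathbb S}(X,B)=\|BX^\dagger\|_2=\sigma^{\rm unstruc}(X,B)$. Moreover, let $r=\mathrm{rank}(X)$, let $X=U\Sigma V^H$ be any singular value decomposition ($U\in\mathbb K^{n\times n}$ and $V\in\mathbb K^{p\times p}$ unitary, $\Sigma$ diagonal with nonnegative, nonincreasing diagonal entries), partition $U=[U_1\ U_2]$ with $U_1\in\mathbb K^{n\times r}$, and put $\mu=\|BX^\dagger\|_2$. *Case I:* $\mathbb S\in\{\mathsf{sym},\mathsf{skew\text{-}sym}\}$. Let $K=BX^\dagger U_1\,(\mu^2I\mp U_1^H\overline{BX^\dagger}BX^\dagger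 U_1)^{-1/2}$, with sign $-$ for $\mathsf{sym}$ and $+$ for $\mathsf{skew\text{-}sym}$. For every $Z\in\mathbb K^{(n-r)\times(n-r)}$ with $\|Z\|_2\le1$ and $Z^T=Z$ (resp. $Z^T=-Z$) when $\mathbb S=\mathsf{sym}$ (resp. $\mathsf{skew\text{-}sym}$), the matrix $$A_o=\mathcal F(X,B)-(I-XX^\dagger)^TKU_1^H\overline{BX^\dagger U_1}K^T(I-XX^\dagger)+\mu\,\overline{U_2}\,(I-U_2^TKK^H\overline{U_2})^{1/2}Z(I-U_2^H\overline KK^TU_2)^{1/2}U_2^H$$ satisfies $A_o\in\mathbb S(X,B)$ and $\|A_o\|_2=\sigma^{\mathbb S}(X,B)$. *Case II:* $\mathbb S=\mathsf{Herm}$. Let $K=BX^\dagger U_1\,(\mu^2I-U_1^HBX^\dagger BX^\dagger U_1)^{-1/2}$. For every $Z\in\mathbb K^{(n-r)\times(n-r)}$ with $\|Z\|_2\le1$ and $Z^H=Z$, the matrix $$A_o=\mathcal F(X,B)-(I-XX^\dagger)KU_1^HBX^\dagger U_1K^H(I-XX^\dagger)+\mu\,U_2\,(I-U_2^HKK^HU_2)^{1/2}Z(I-U_2^HKK^HU_2)^{1/2}U_2^H$$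 satisfies $A_o\in\mathbb S(X,B)$ and $\|A_o\|_2=\sigma^{\mathbb S}(X,B)$. -/

import Mathlib

open scoped Matrix

noncomputable section

namespace StructMap

variable {𝕜 : Type*} [RCLike 𝕜]

/-- The four Penrose equations: `G` is the Moore-Penrose pseudoinverse of `A`. -/
structure IsMoorePenrose {m n : ℕ} (A : Matrix (Fin m) (Fin n) 𝕜)
    (G : Matrix (Fin n) (Fin m) 𝕜) : Prop where
  mul_mul_self : A * G * A = A
  mul_mul_inv : G * A * G = G
  isHermitian_left : (A * G)ᴴ = A * G
  isHermitian_right : (G * A)ᴴ = G * A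

open scoped ComplexOrder in
theorem exists_isMoorePenrose {m n : ℕ} (A : Matrix (Fin m) (Fin n) 𝕜) :
    ∃ G, IsMoorePenrose A G := by
  have hH : (Aᴴ * A).IsHermitian := Matrix.isHermitian_conjTranspose_mul_self A
  obtain ⟨W, hMW, hWH, hWMW, hcomm⟩ : ∃ W : Matrix (Fin n) (Fin n) 𝕜,
      (Aᴴ * A) * W * (Aᴴ * A) = Aᴴ * A ∧ Wᴴ = W ∧ W * (Aᴴ * A) * W = W ∧
        (Aᴴ * A) * W = W * (Aᴴ * A) := by
    have hsp := hH.spectral_theorem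
    rw [Unitary.conjStarAlgAut_apply] at hsp
    set U : Matrix (Fin n) (Fin n) 𝕜 := (hH.eigenvectorUnitary : Matrix (Fin n) (Fin n) 𝕜)
    have hU : star U * U = 1 := Unitary.coe_star_mul_self hH.eigenvectorUnitary
    set d : Fin n → 𝕜 := RCLike.ofReal ∘ hH.eigenvalues with hd
    have key : ∀ D E F : Matrix (Fin n) (Fin n) 𝕜,
        (U * D * star U) * (U * E * star U) * (U * F * star U) = U * (D * E * F) * star U := by
      intro D E F
      calc _ = U * D * (star U * U) * E * (star U * U) * F * star U := by
            simp only [Matrix.mul_assoc]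
        _ = _ := by rw [hU]; simp only [Matrix.mul_assoc, Matrix.mul_one]
    have key2 : ∀ D E : Matrix (Fin n) (Fin n) 𝕜,
        (U * D * star U) * (U * E * star U) = U * (D * E) * star U := by
      intro D E
      calc _ = U * D * (star U * U) * E * star U := by simp only [Matrix.mul_assoc]
        _ = _ := by rw [hU]; simp only [Matrix.mul_assoc, Matrix.mul_one]
    have h0 : ∀ x : 𝕜, x * x⁻¹ * x = x := mul_inv_mul_cancel
    refine ⟨U * Matrix.diagonal (fun i => (d i)⁻¹) * star U, ?_, ?_, ?_, ?_⟩
    · rw [hsp, key, Matrix.diagonal_mul_diagonal, Matrix.diagonal_mul_diagonal]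
      simp only [h0]
    · simp only [Matrix.star_eq_conjTranspose, Matrix.conjTranspose_mul,
        Matrix.conjTranspose_conjTranspose, Matrix.diagonal_conjTranspose, Matrix.mul_assoc]
      congr 3
      funext i
      simp [hd]
    · rw [hsp, key, Matrix.diagonal_mul_diagonal, Matrix.diagonal_mul_diagonal]
      congr 3
      funext i
      simpa using h0 (d i)⁻¹
    · rw [hsp, key2, key2, Matrix.diagonal_mul_diagonal, Matrix.diagonal_mul_diagonal]
      simp only [mul_comm]
  have hA : A * (W * (Aᴴ * A)) = A := by
    have h : Aᴴ * A * (W * (Aᴴ * A) - 1) = 0 := by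
      rw [Matrix.mul_sub, Matrix.mul_one, ← Matrix.mul_assoc, hMW, sub_self]
    rw [Matrix.conjTranspose_mul_self_mul_eq_zero, Matrix.mul_sub, Matrix.mul_one,
      sub_eq_zero] at h
    exact h
  refine ⟨W * Aᴴ, ?_, ?_, ?_, ?_⟩
  · simpa only [Matrix.mul_assoc] using hA
  · calc W * Aᴴ * A * (W * Aᴴ) = (W * (Aᴴ * A) * W) * Aᴴ := by simp only [Matrix.mul_assoc]
      _ = W * Aᴴ := by rw [hWMW]
  · simp only [Matrix.conjTranspose_mul, Matrix.conjTranspose_conjTranspose, hWH,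
      Matrix.mul_assoc]
  · rw [Matrix.mul_assoc, ← hcomm]
    simp only [Matrix.conjTranspose_mul, Matrix.conjTranspose_conjTranspose, hWH, hcomm]

theorem IsMoorePenrose.unique {m n : ℕ} {A : Matrix (Fin m) (Fin n) 𝕜}
    {G G' : Matrix (Fin n) (Fin m) 𝕜} (h : IsMoorePenrose A G) (h' : IsMoorePenrose A G') :
    G = G' := by
  have h1 : A * G = A * G' := by
    calc A * G = (A * G' * A) * G := by rw [h'.mul_mul_self]
      _ = (A * G')ᴴ * (A * G)ᴴ := by
        rw [h.isHermitian_left, h'.isHermitian_left]; simp only [Matrix.mul_assoc]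
      _ = ((A * G * A) * G')ᴴ := by rw [← Matrix.conjTranspose_mul]; simp only [Matrix.mul_assoc]
      _ = A * G' := by rw [h.mul_mul_self, h'.isHermitian_left]
  have h2 : G * A = G' * A := by
    calc G * A = G * (A * G' * A) := by rw [h'.mul_mul_self]
      _ = (G * A)ᴴ * (G' * A)ᴴ := by
        rw [h.isHermitian_right, h'.isHermitian_right]; simp only [Matrix.mul_assoc]
      _ = (G' * (A * G * A))ᴴ := by rw [← Matrix.conjTranspose_mul]; simp only [Matrix.mul_assoc]
      _ = G' * A := by rw [h.mul_mul_self, h'.isHermitian_right]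
  calc G = G * A * G := h.mul_mul_inv.symm
    _ = G' * (A * G) := by rw [h2, Matrix.mul_assoc]
    _ = G' * A * G' := by rw [h1, Matrix.mul_assoc]
    _ = G' := h'.mul_mul_inv

/-- The Moore-Penrose pseudoinverse of a matrix. -/
def pinv {m n : ℕ} (A : Matrix (Fin m) (Fin n) 𝕜) : Matrix (Fin n) (Fin m) 𝕜 :=
  (exists_isMoorePenrose A).choose

theorem pinv_spec {m n : ℕ} (A : Matrix (Fin m) (Fin n) 𝕜) : IsMoorePenrose A (pinv A) :=
  (exists_isMoorePenrose A).choose_spec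

open scoped Matrix.Norms.Frobenius in
/-- The Frobenius norm. -/
def frobNorm {m n : ℕ} (A : Matrix (Fin m) (Fin n) 𝕜) : ℝ := ‖A‖

open scoped Matrix.Norms.L2Operator in
/-- The spectral norm (the operator norm for the Euclidean norms). -/
def specNorm {m n : ℕ} (A : Matrix (Fin m) (Fin n) 𝕜) : ℝ := ‖A‖

open scoped MatrixOrder in
/-- The positive semidefinite square root of a positive semidefinite matrix. -/
def psdSqrt {n : ℕ} (A : Matrix (Fin n) (Fin n) 𝕜) : Matrix (Fin n) (Fin n) 𝕜 := CFC.sqrt A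

/-- The power `A ^ (-1/2)` of a positive semidefinite matrix, the inverse being read as the
Moore-Penrose pseudoinverse when `A` is singular. -/
def psdInvSqrt {n : ℕ} (A : Matrix (Fin n) (Fin n) 𝕜) : Matrix (Fin n) (Fin n) 𝕜 :=
  pinv (psdSqrt A)

/-- Entrywise complex conjugate. -/
def conj {m n : ℕ} (A : Matrix (Fin m) (Fin n) 𝕜) : Matrix (Fin m) (Fin n) 𝕜 :=
  A.map (starRingEnd 𝕜)

/-- The three classes of structured matrices. -/
inductive StructClass
  | sym
  | skewSym
  | herm

/-- The set of `n × n` matrices of the given class. -/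
def StructClass.matrices (𝕜 : Type*) [RCLike 𝕜] (n : ℕ) :
    StructClass → Set (Matrix (Fin n) (Fin n) 𝕜)
  | .sym => {A | Aᵀ = A}
  | .skewSym => {A | Aᵀ = -A}
  | .herm => {A | Aᴴ = A}

/-- `𝕊(X, B)`: all `A ∈ 𝕊` with `A X = B`. -/
def solutions {n p : ℕ} (S : Set (Matrix (Fin n) (Fin n) 𝕜)) (X B : Matrix (Fin n) (Fin p) 𝕜) :
    Set (Matrix (Fin n) (Fin n) 𝕜) :=
  {A | A ∈ S ∧ A * X = B}

/-- `σ^𝕊(X, B)`: the infimum of the norm `N` over `𝕊(X, B)`. -/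
def sigma {n p : ℕ} (N : Matrix (Fin n) (Fin n) 𝕜 → ℝ) (S : Set (Matrix (Fin n) (Fin n) 𝕜))
    (X B : Matrix (Fin n) (Fin p) 𝕜) : ℝ :=
  sInf (N '' solutions S X B)

/-- `𝓕_T(X, B)` (classes `sym` and `skewSym`) and `𝓕_H(X, B)` (class `herm`). -/
def solMap {n p : ℕ} (S : StructClass) (X B : Matrix (Fin n) (Fin p) 𝕜) :
    Matrix (Fin n) (Fin n) 𝕜 :=
  match S with
  | .sym => B * pinv X + (B * pinv X)ᵀ - (pinv X)ᵀ * (Xᵀ * B) * pinv X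
  | .skewSym => B * pinv X - (B * pinv X)ᵀ - (pinv X)ᵀ * (Xᵀ * B) * pinv X
  | .herm => B * pinv X + (B * pinv X)ᴴ - (pinv X)ᴴ * (Xᴴ * B) * pinv X

/-- `Pᵀ` for the classes `sym` and `skewSym`, and `P` itself for the class `herm`. -/
def StructClass.twist {n : ℕ} (S : StructClass) (P : Matrix (Fin n) (Fin n) 𝕜) :
    Matrix (Fin n) (Fin n) 𝕜 :=
  match S with
  | .sym => Pᵀ
  | .skewSym => Pᵀ
  | .herm => P

/-- `X = U Σ Vᴴ` is a singular value decomposition: `U`, `V` are unitary and `Σ` is (rectangular)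
diagonal with nonnegative, nonincreasing diagonal entries. -/
structure IsSVD {n p : ℕ} (X : Matrix (Fin n) (Fin p) 𝕜) (U : Matrix (Fin n) (Fin n) 𝕜)
    (Sig : Matrix (Fin n) (Fin p) 𝕜) (V : Matrix (Fin p) (Fin p) 𝕜) : Prop where
  unitary_left : U ∈ Matrix.unitaryGroup (Fin n) 𝕜
  unitary_right : V ∈ Matrix.unitaryGroup (Fin p) 𝕜
  diag : ∃ s : ℕ → ℝ, (∀ i, 0 ≤ s i) ∧ Antitone s ∧
    ∀ (i : Fin n) (j : Fin p), Sig i j = if (i : ℕ) = (j : ℕ) then ((s i : ℝ) : 𝕜) else 0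
  eq_mul : X = U * Sig * Vᴴ

theorem rank_le_rows {n p : ℕ} (X : Matrix (Fin n) (Fin p) 𝕜) : X.rank ≤ n := by
  simpa using X.rank_le_card_height

/-- The first `r` columns of `U`. -/
def firstCols {n r : ℕ} (h : r ≤ n) (U : Matrix (Fin n) (Fin n) 𝕜) : Matrix (Fin n) (Fin r) 𝕜 :=
  Matrix.of fun i j => U i ⟨j, lt_of_lt_of_le j.2 h⟩

/-- The last `n - r` columns of `U`. -/
def lastCols {n r : ℕ} (h : r ≤ n) (U : Matrix (Fin n) (Fin n) 𝕜) :
    Matrix (Fin n) (Fin (n - r)) 𝕜 :=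
  Matrix.of fun i j => U i ⟨r + j, by have := j.2; omega⟩

/-- The matrix `K`, with `G = B X†`, `μ = ‖B X†‖₂` and `U₁` the first `rank X` columns of `U`. -/
def dilK {n p r : ℕ} (S : StructClass) (X B : Matrix (Fin n) (Fin p) 𝕜)
    (U₁ : Matrix (Fin n) (Fin r) 𝕜) : Matrix (Fin n) (Fin r) 𝕜 :=
  let G := B * pinv X
  let μ : 𝕜 := ((specNorm G : ℝ) : 𝕜)
  match S with
  | .sym => G * U₁ * psdInvSqrt (μ ^ 2 • 1 - U₁ᴴ * conj G * G * U₁)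
  | .skewSym => G * U₁ * psdInvSqrt (μ ^ 2 • 1 + U₁ᴴ * conj G * G * U₁)
  | .herm => G * U₁ * psdInvSqrt (μ ^ 2 • 1 - U₁ᴴ * G * G * U₁)

/-- The matrix `A_o` of the spectral norm problem, for a partition `[U₁ U₂]` of the left factor of
an SVD of `X` and a contraction `Z`. -/
def dilSol {n p r q : ℕ} (S : StructClass) (X B : Matrix (Fin n) (Fin p) 𝕜)
    (U₁ : Matrix (Fin n) (Fin r) 𝕜) (U₂ : Matrix (Fin n) (Fin q) 𝕜)
    (Z : Matrix (Fin q) (Fin q) 𝕜) : Matrix (Fin n) (Fin n) 𝕜 :=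
  let G := B * pinv X
  let μ : 𝕜 := ((specNorm G : ℝ) : 𝕜)
  let K := dilK S X B U₁
  let Q := 1 - X * pinv X
  match S with
  | .herm =>
      solMap .herm X B - Q * K * U₁ᴴ * (G * U₁) * Kᴴ * Q
        + μ • (U₂ * psdSqrt (1 - U₂ᴴ * K * Kᴴ * U₂) * Z
            * psdSqrt (1 - U₂ᴴ * K * Kᴴ * U₂) * U₂ᴴ)
  | .sym | .skewSym =>
      solMap S X B - Qᵀ * K * U₁ᴴ * conj (G * U₁) * Kᵀ * Q
        + μ • (conj U₂ * psdSqrt (1 - U₂ᵀ * K * Kᴴ * conj U₂) * Z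
            * psdSqrt (1 - U₂ᴴ * conj K * Kᵀ * U₂) * U₂ᴴ)

end StructMap

end

/-!
For each class there is an additive involution `σ` on matrices, `A ↦ Aᵀ`, `A ↦ -Aᵀ` or `A ↦ Aᴴ`,
and the structured matrices are its fixed points. Write `P = X X†`, `Q = 1 - P`, and `τ` for the
transpose, respectively the conjugate transpose. If `A` is one solution, then `B X† = A P`, and
`𝓕(X, B) = A - τ(Q) A Q`: all solutions differ only in the corner `τ(Q) A Q`, which is arbitrary
structured, and `𝓕(X, B)` is the solution whose corner vanishes. Pythagoras for `P` and `Q` on both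
sides gives the Frobenius norm statements.

For the spectral norm, write `A` in block form `[[a, σ(b)], [b, d]]` along the partition `[U₁ U₂]`.
The first block column is determined by the data, has norm at most `μ = ‖B X†‖`, and `d` is free.
With `D = (μ² - aᴴ a)^{1/2}` one has `b = K D` for the contraction `K = b D†`, and the corners
`d = -K aᴴ σ(K) + μ (1 - K Kᴴ)^{1/2} Z (1 - σ(K)ᴴ σ(K))^{1/2}` complete the block column to a
matrix of norm at most `μ` (Davis, Kahan and Weinberger): the completion is the Julia operator
of `a`, of norm at most `μ`, together with the free block `μ Z`, compressed by contractions built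
from `K` and `σ(K)`. No solution has a smaller norm, because `‖A P‖ ≤ ‖A‖`.
-/

noncomputable section

namespace StructMap

variable {𝕜 : Type*} [RCLike 𝕜]

namespace StructClass

variable {l m n : Type*} (S : StructClass)

/-- The involution of a class: the transpose for `sym` and `skewSym`, the conjugate transpose for
`herm`. It replaces `ᵀ` and `ᴴ` where the formulas for the three classes have the same shape, and
`(S.adj A)ᴴ` plays the role of the entrywise conjugate. -/
def adj (A : Matrix m n 𝕜) : Matrix n m 𝕜 :=
  match S with
  | .sym | .skewSym => Aᵀ
  | .herm => Aᴴ

/-- The involution of a class with its sign (`-Aᵀ` for `skewSym`), so that the structured matrices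
are its fixed points. -/
def signedAdj (A : Matrix m n 𝕜) : Matrix n m 𝕜 :=
  match S with
  | .sym => Aᵀ
  | .skewSym => -Aᵀ
  | .herm => Aᴴ

theorem mem_matrices_iff {k : ℕ} {A : Matrix (Fin k) (Fin k) 𝕜} :
    A ∈ S.matrices 𝕜 k ↔ S.signedAdj A = A := by
  cases S <;> simp [matrices, signedAdj, neg_eq_iff_eq_neg]

theorem adj_mul [Fintype m] (A : Matrix l m 𝕜) (B : Matrix m n 𝕜) :
    S.adj (A * B) = S.adj B * S.adj A := by
  cases S <;> simp [adj]

theorem adj_sub (A B : Matrix m n 𝕜) : S.adj (A - B) = S.adj A - S.adj B := by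
  cases S <;> simp [adj]

theorem adj_one [DecidableEq n] : S.adj (1 : Matrix n n 𝕜) = 1 := by
  cases S <;> simp [adj]

theorem adj_adj (A : Matrix m n 𝕜) : S.adj (S.adj A) = A := by
  cases S <;> simp [adj]

theorem adj_conjTranspose (A : Matrix m n 𝕜) : S.adj Aᴴ = (S.adj A)ᴴ := by
  cases S <;> rfl

theorem signedAdj_add (A B : Matrix m n 𝕜) :
    S.signedAdj (A + B) = S.signedAdj A + S.signedAdj B := by
  cases S <;> simp [signedAdj, add_comm]

theorem signedAdj_smul (c : ℝ) (A : Matrix m n 𝕜) : S.signedAdj (c • A) = c • S.signedAdj A := by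
  cases S <;> simp [signedAdj]

theorem signedAdj_mul_left [Fintype m] (A : Matrix l m 𝕜) (B : Matrix m n 𝕜) :
    S.signedAdj (A * B) = S.signedAdj B * S.adj A := by
  cases S <;> simp [adj, signedAdj]

theorem signedAdj_mul_right [Fintype m] (A : Matrix l m 𝕜) (B : Matrix m n 𝕜) :
    S.signedAdj (A * B) = S.adj B * S.signedAdj A := by
  cases S <;> simp [adj, signedAdj]

theorem isStarProjection_adj [Fintype n] {P : Matrix n n 𝕜} (hP : IsStarProjection P) :
    IsStarProjection (S.adj P) where
  isIdempotentElem := by rw [IsIdempotentElem, ← adj_mul, hP.isIdempotentElem.eq]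
  isSelfAdjoint := by
    rw [IsSelfAdjoint, Matrix.star_eq_conjTranspose, ← adj_conjTranspose,
      hP.isSelfAdjoint.isHermitian.eq]

theorem twist_eq_adj {k : ℕ} {P : Matrix (Fin k) (Fin k) 𝕜} (hP : Pᴴ = P) :
    S.twist P = S.adj P := by
  cases S <;> simp [twist, adj, hP]

/-- The structured matrices of a class as a real subspace; for `herm` over `ℂ` they do not form a
complex one. -/
def realSubspace (𝕜 : Type*) [RCLike 𝕜] (S : StructClass) (k : ℕ) :
    Submodule ℝ (Matrix (Fin k) (Fin k) 𝕜) where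
  carrier := S.matrices 𝕜 k
  zero_mem' := by cases S <;> simp [matrices]
  add_mem' hA hB := by
    rw [mem_matrices_iff] at *
    rw [signedAdj_add, hA, hB]
  smul_mem' c A hA := by
    rw [mem_matrices_iff] at *
    rw [signedAdj_smul, hA]

variable {S}

theorem adj_mul_mul_mem_matrices {j k : ℕ} {A : Matrix (Fin j) (Fin j) 𝕜}
    (hA : A ∈ S.matrices 𝕜 j) (W : Matrix (Fin j) (Fin k) 𝕜) :
    S.adj W * A * W ∈ S.matrices 𝕜 k := by
  rw [mem_matrices_iff] at *
  rw [signedAdj_mul_right, signedAdj_mul_left, hA, adj_adj, Matrix.mul_assoc]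

end StructClass

section ColumnProjection

variable {n p : ℕ} (X : Matrix (Fin n) (Fin p) 𝕜)

theorem isStarProjection_mul_pinv : IsStarProjection (X * pinv X) where
  isIdempotentElem := by
    rw [IsIdempotentElem, ← Matrix.mul_assoc, (pinv_spec X).mul_mul_self]
  isSelfAdjoint := (pinv_spec X).isHermitian_left

theorem one_sub_mul_pinv_mul_self : (1 - X * pinv X) * X = 0 := by
  rw [Matrix.sub_mul, (pinv_spec X).mul_mul_self, Matrix.one_mul, sub_self]

end ColumnProjection

section Solutions

variable {n p : ℕ} {S : StructClass} {X B : Matrix (Fin n) (Fin p) 𝕜}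
  {A C : Matrix (Fin n) (Fin n) 𝕜}

theorem mul_pinv_of_mul_eq (hA : A * X = B) : B * pinv X = A * (X * pinv X) := by
  rw [← hA, Matrix.mul_assoc]

theorem add_mem_solutions (hA : A ∈ solutions (S.matrices 𝕜 n) X B)
    (hC : C ∈ S.matrices 𝕜 n) (hCX : C * X = 0) : A + C ∈ solutions (S.matrices 𝕜 n) X B :=
  ⟨(S.realSubspace 𝕜 n).add_mem hA.1 hC, by rw [Matrix.add_mul, hA.2, hCX, add_zero]⟩

theorem solMap_eq (S : StructClass) (X B : Matrix (Fin n) (Fin p) 𝕜) :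
    solMap S X B = B * pinv X + S.signedAdj (B * pinv X)
      - S.adj (X * pinv X) * (B * pinv X) := by
  cases S <;>
    simp [solMap, StructClass.adj, StructClass.signedAdj, Matrix.mul_assoc, sub_eq_add_neg]

theorem solMap_eq_sub (hA : A ∈ solutions (S.matrices 𝕜 n) X B) :
    solMap S X B = A - S.adj (1 - X * pinv X) * A * (1 - X * pinv X) := by
  rw [solMap_eq, mul_pinv_of_mul_eq hA.2, S.signedAdj_mul_right, S.mem_matrices_iff.1 hA.1,
    S.adj_sub, S.adj_one]
  noncomm_ring

theorem compression_mul_eq_zero :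
    S.adj (1 - X * pinv X) * A * (1 - X * pinv X) * X = 0 := by
  rw [Matrix.mul_assoc, one_sub_mul_pinv_mul_self, Matrix.mul_zero]

theorem solMap_mem_solutions (hne : (solutions (S.matrices 𝕜 n) X B).Nonempty) :
    solMap S X B ∈ solutions (S.matrices 𝕜 n) X B := by
  obtain ⟨A, hA⟩ := hne
  rw [solMap_eq_sub hA, sub_eq_add_neg]
  refine add_mem_solutions hA ?_ ?_
  · exact (S.realSubspace 𝕜 n).neg_mem (StructClass.adj_mul_mul_mem_matrices hA.1 _)
  · rw [Matrix.neg_mul, compression_mul_eq_zero, neg_zero]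

theorem mem_solutions_iff_exists (hne : (solutions (S.matrices 𝕜 n) X B).Nonempty) :
    A ∈ solutions (S.matrices 𝕜 n) X B ↔ ∃ Z ∈ S.matrices 𝕜 n,
      A = solMap S X B + S.twist (1 - X * pinv X) * Z * (1 - X * pinv X) := by
  rw [S.twist_eq_adj (isStarProjection_mul_pinv X).one_sub.isSelfAdjoint]
  constructor
  · intro hA
    exact ⟨A, hA.1, by rw [solMap_eq_sub hA, sub_add_cancel]⟩
  · rintro ⟨Z, hZ, rfl⟩
    exact add_mem_solutions (solMap_mem_solutions hne)
      (StructClass.adj_mul_mul_mem_matrices hZ _) compression_mul_eq_zero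

end Solutions

section FrobeniusNorm

variable {k l : ℕ}

open scoped Matrix.Norms.Frobenius in
theorem frobNorm_nonneg (A : Matrix (Fin k) (Fin l) 𝕜) : 0 ≤ frobNorm A := norm_nonneg _

open scoped Matrix.Norms.Frobenius in
theorem frobNorm_eq_zero {A : Matrix (Fin k) (Fin l) 𝕜} : frobNorm A = 0 ↔ A = 0 := norm_eq_zero

open scoped Matrix.Norms.Frobenius in
theorem ofReal_frobNorm_sq (A : Matrix (Fin k) (Fin l) 𝕜) :
    ((frobNorm A ^ 2 : ℝ) : 𝕜) = (Aᴴ * A).trace := by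
  have h0 : 0 ≤ ∑ i, ∑ j, ‖A i j‖ ^ (2 : ℝ) := by positivity
  rw [frobNorm, Matrix.frobenius_norm_def, ← Real.sqrt_eq_rpow, Real.sq_sqrt h0, Finset.sum_comm]
  simp [Matrix.trace, Matrix.mul_apply, RCLike.conj_mul]

open scoped Matrix.Norms.Frobenius in
theorem frobNorm_conjTranspose (A : Matrix (Fin k) (Fin l) 𝕜) : frobNorm Aᴴ = frobNorm A :=
  Matrix.frobenius_norm_conjTranspose A

open scoped Matrix.Norms.Frobenius in
theorem frobNorm_signedAdj (S : StructClass) (A : Matrix (Fin k) (Fin l) 𝕜) :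
    frobNorm (S.signedAdj A) = frobNorm A := by
  cases S
  · exact Matrix.frobenius_norm_transpose A
  · exact (norm_neg Aᵀ).trans (Matrix.frobenius_norm_transpose A)
  · exact Matrix.frobenius_norm_conjTranspose A

theorem frobNorm_sq_eq_add_left {P : Matrix (Fin k) (Fin k) 𝕜} (hP : IsStarProjection P)
    (A : Matrix (Fin k) (Fin l) 𝕜) :
    frobNorm A ^ 2 = frobNorm (P * A) ^ 2 + frobNorm ((1 - P) * A) ^ 2 := by
  have gram {Q : Matrix (Fin k) (Fin k) 𝕜} (hQ : IsStarProjection Q) :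
      (Q * A)ᴴ * (Q * A) = Aᴴ * (Q * A) := by
    rw [Matrix.conjTranspose_mul, hQ.isSelfAdjoint.isHermitian.eq, Matrix.mul_assoc,
      ← Matrix.mul_assoc Q, hQ.isIdempotentElem.eq]
  apply RCLike.ofReal_injective (K := 𝕜)
  rw [RCLike.ofReal_add, ofReal_frobNorm_sq, ofReal_frobNorm_sq, ofReal_frobNorm_sq, gram hP,
    gram hP.one_sub, ← Matrix.trace_add, ← Matrix.mul_add, ← Matrix.add_mul, add_sub_cancel,
    Matrix.one_mul]

theorem frobNorm_sq_eq_add_right {P : Matrix (Fin l) (Fin l) 𝕜} (hP : IsStarProjection P)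
    (A : Matrix (Fin k) (Fin l) 𝕜) :
    frobNorm A ^ 2 = frobNorm (A * P) ^ 2 + frobNorm (A * (1 - P)) ^ 2 := by
  have h {Q : Matrix (Fin l) (Fin l) 𝕜} (hQ : IsStarProjection Q) :
      frobNorm (Q * Aᴴ) = frobNorm (A * Q) := by
    rw [← frobNorm_conjTranspose (A * Q), Matrix.conjTranspose_mul,
      hQ.isSelfAdjoint.isHermitian.eq]
  rw [← frobNorm_conjTranspose, frobNorm_sq_eq_add_left hP, h hP, h hP.one_sub]

end FrobeniusNorm

section FrobeniusSolution

variable {n p : ℕ} {S : StructClass} {X B : Matrix (Fin n) (Fin p) 𝕜}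
  {A : Matrix (Fin n) (Fin n) 𝕜}

theorem frobNorm_sq_of_mem_solutions (hA : A ∈ solutions (S.matrices 𝕜 n) X B) :
    frobNorm A ^ 2 = 2 * frobNorm (B * pinv X) ^ 2
      - frobNorm (S.adj (X * pinv X) * (B * pinv X)) ^ 2
      + frobNorm (S.adj (1 - X * pinv X) * A * (1 - X * pinv X)) ^ 2 := by
  have hP := isStarProjection_mul_pinv X
  have hA_split := frobNorm_sq_eq_add_right hP A
  have hAP_split := frobNorm_sq_eq_add_left (S.isStarProjection_adj hP) (A * (X * pinv X))
  have hQA_split := frobNorm_sq_eq_add_right hP (S.adj (1 - X * pinv X) * A)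
  have hAQ : frobNorm (S.adj (1 - X * pinv X) * A) = frobNorm (A * (1 - X * pinv X)) := by
    rw [← frobNorm_signedAdj S (A * _), S.signedAdj_mul_right, S.mem_matrices_iff.1 hA.1]
  rw [mul_pinv_of_mul_eq hA.2, hA_split, ← hAQ, hQA_split]
  rw [S.adj_sub, S.adj_one] at *
  rw [Matrix.mul_assoc (1 - S.adj (X * pinv X)) A (X * pinv X)]
  linarith

theorem frobNorm_solMap_sq (hne : (solutions (S.matrices 𝕜 n) X B).Nonempty) :
    frobNorm (solMap S X B) ^ 2 = 2 * frobNorm (B * pinv X) ^ 2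
      - frobNorm (S.adj (X * pinv X) * (B * pinv X)) ^ 2 := by
  have hF := solMap_mem_solutions hne
  have h0 : S.adj (1 - X * pinv X) * solMap S X B * (1 - X * pinv X) = 0 :=
    sub_eq_self.1 (solMap_eq_sub hF).symm
  rw [frobNorm_sq_of_mem_solutions hF, h0, frobNorm_eq_zero.2 rfl, zero_pow two_ne_zero, add_zero]

theorem frobNorm_sq_eq_solMap_add (hA : A ∈ solutions (S.matrices 𝕜 n) X B) :
    frobNorm A ^ 2 = frobNorm (solMap S X B) ^ 2 + frobNorm (A - solMap S X B) ^ 2 := by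
  have hsub : A - solMap S X B = S.adj (1 - X * pinv X) * A * (1 - X * pinv X) := by
    rw [solMap_eq_sub hA, sub_sub_cancel]
  rw [frobNorm_sq_of_mem_solutions hA, frobNorm_solMap_sq ⟨A, hA⟩, hsub]

theorem sigma_frobNorm (hne : (solutions (S.matrices 𝕜 n) X B).Nonempty) :
    sigma frobNorm (S.matrices 𝕜 n) X B = frobNorm (solMap S X B) := by
  refine IsLeast.csInf_eq ⟨⟨_, solMap_mem_solutions hne, rfl⟩, ?_⟩
  rintro _ ⟨A, hA, rfl⟩
  refine le_of_sq_le_sq ?_ (frobNorm_nonneg A)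
  linarith [frobNorm_sq_eq_solMap_add hA, sq_nonneg (frobNorm (A - solMap S X B))]

theorem eq_solMap_of_frobNorm_eq (hA : A ∈ solutions (S.matrices 𝕜 n) X B)
    (h : frobNorm A = frobNorm (solMap S X B)) : A = solMap S X B := by
  have hpyth := frobNorm_sq_eq_solMap_add hA
  rw [h, left_eq_add, sq_eq_zero_iff, frobNorm_eq_zero] at hpyth
  exact sub_eq_zero.1 hpyth

theorem ofReal_frobNorm_adj_mul_sq (S : StructClass) (X B : Matrix (Fin n) (Fin p) 𝕜) :
    ((frobNorm (S.adj (X * pinv X) * (B * pinv X)) ^ 2 : ℝ) : 𝕜) =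
      (B * pinv X * (B * pinv X)ᴴ * S.twist (X * pinv X)).trace := by
  have hP := isStarProjection_mul_pinv X
  have hT := S.isStarProjection_adj hP
  rw [S.twist_eq_adj hP.isSelfAdjoint, ofReal_frobNorm_sq, Matrix.conjTranspose_mul,
    hT.isSelfAdjoint.isHermitian.eq, Matrix.mul_assoc, ← Matrix.mul_assoc (S.adj _),
    hT.isIdempotentElem.eq, ← Matrix.mul_assoc, Matrix.trace_mul_comm, ← Matrix.mul_assoc]

end FrobeniusSolution

section SpectralNorm

open scoped Matrix.Norms.L2Operator ComplexOrder

theorem posSemidef_fromBlocks_diagonal {m n : Type*} [Finite m] [Finite n] {A : Matrix m m 𝕜}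
    {D : Matrix n n 𝕜} (hA : A.PosSemidef) (hD : D.PosSemidef) :
    (Matrix.fromBlocks A 0 0 D).PosSemidef := by
  classical
  have := Fintype.ofFinite m
  have := Fintype.ofFinite n
  have hsum := (hA.conjTranspose_mul_mul_same (Matrix.fromCols (1 : Matrix m m 𝕜) 0)).add
    (hD.conjTranspose_mul_mul_same (Matrix.fromCols 0 (1 : Matrix n n 𝕜)))
  convert hsum using 1
  ext (i | i) (j | j) <;>
    simp [Matrix.conjTranspose_fromCols_eq_fromRows_conjTranspose, Matrix.fromRows_mul]

variable {m n k l : Type*} [Fintype m] [Fintype n] [Fintype k] [Fintype l]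

theorem star_dotProduct_self (x : EuclideanSpace 𝕜 n) :
    star x.ofLp ⬝ᵥ x.ofLp = ((‖x‖ ^ 2 : ℝ) : 𝕜) := by
  rw [EuclideanSpace.norm_sq_eq]
  simp [dotProduct, RCLike.conj_mul]

variable [DecidableEq n]

theorem star_dotProduct_sub_gram_mulVec (A : Matrix m n 𝕜) (c : ℝ) (x : EuclideanSpace 𝕜 n) :
    star x.ofLp ⬝ᵥ (((c : 𝕜) ^ 2 • (1 : Matrix n n 𝕜) - Aᴴ * A) *ᵥ x.ofLp) =
      (((c * ‖x‖) ^ 2 - ‖WithLp.toLp 2 (A *ᵥ x.ofLp)‖ ^ 2 : ℝ) : 𝕜) := by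
  have hgram := star_dotProduct_self (WithLp.toLp 2 (A *ᵥ x.ofLp))
  rw [Matrix.sub_mulVec, dotProduct_sub, Matrix.smul_mulVec, Matrix.one_mulVec, dotProduct_smul,
    star_dotProduct_self, ← Matrix.mulVec_mulVec, Matrix.dotProduct_mulVec,
    Matrix.vecMul_conjTranspose, star_star, hgram]
  simp [mul_pow]

theorem l2_opNorm_le_iff_posSemidef (A : Matrix m n 𝕜) {c : ℝ} (hc : 0 ≤ c) :
    ‖A‖ ≤ c ↔ ((c : 𝕜) ^ 2 • (1 : Matrix n n 𝕜) - Aᴴ * A).PosSemidef := by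
  have hbound : ‖A‖ ≤ c ↔ ∀ x : EuclideanSpace 𝕜 n, ‖WithLp.toLp 2 (A *ᵥ x.ofLp)‖ ≤ c * ‖x‖ :=
    ⟨fun h x => (Matrix.l2_opNorm_mulVec A x).trans (by gcongr),
      fun h => ContinuousLinearMap.opNorm_le_bound _ hc h⟩
  have hquad (x : EuclideanSpace 𝕜 n) : ‖WithLp.toLp 2 (A *ᵥ x.ofLp)‖ ≤ c * ‖x‖ ↔
      0 ≤ star x.ofLp ⬝ᵥ (((c : 𝕜) ^ 2 • (1 : Matrix n n 𝕜) - Aᴴ * A) *ᵥ x.ofLp) := by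
    rw [star_dotProduct_sub_gram_mulVec, RCLike.ofReal_nonneg, sub_nonneg,
      sq_le_sq₀ (norm_nonneg _) (by positivity)]
  have hherm : ((c : 𝕜) ^ 2 • (1 : Matrix n n 𝕜) - Aᴴ * A).IsHermitian := by
    simp [Matrix.IsHermitian]
  rw [hbound, Matrix.posSemidef_iff_dotProduct_mulVec, and_iff_right hherm]
  exact ⟨fun h x => (hquad (WithLp.toLp 2 x)).1 (h _), fun h x => (hquad x).2 (h x.ofLp)⟩

theorem l2_opNorm_le_of_conjTranspose_mul_self {A : Matrix m n 𝕜} {c : ℝ} (hc : 0 ≤ c)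
    (h : Aᴴ * A = (c : 𝕜) ^ 2 • 1) : ‖A‖ ≤ c := by
  rw [l2_opNorm_le_iff_posSemidef A hc, h, sub_self]
  exact Matrix.PosSemidef.zero

open scoped Classical in
theorem l2_opNorm_le_one_of_isStarProjection {W : Matrix m n 𝕜}
    (h : IsStarProjection (W * Wᴴ)) : ‖W‖ ≤ 1 := by
  have hsq : ‖W‖ * ‖W‖ ≤ 1 := by
    simpa [Matrix.l2_opNorm_conjTranspose] using
      (Matrix.l2_opNorm_conjTranspose_mul_self Wᴴ).symm.trans_le (by simpa using h.norm_le)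
  nlinarith [norm_nonneg W]

theorem l2_opNorm_fromBlocks_diagonal_le [DecidableEq l] {A : Matrix m n 𝕜} {D : Matrix k l 𝕜}
    {c : ℝ} (hA : ‖A‖ ≤ c) (hD : ‖D‖ ≤ c) : ‖Matrix.fromBlocks A 0 0 D‖ ≤ c := by
  have hc : 0 ≤ c := (norm_nonneg A).trans hA
  rw [l2_opNorm_le_iff_posSemidef _ hc] at *
  convert posSemidef_fromBlocks_diagonal hA hD using 1
  simp [← Matrix.fromBlocks_one, Matrix.fromBlocks_smul, Matrix.fromBlocks_conjTranspose,
    Matrix.fromBlocks_multiply, sub_eq_add_neg, Matrix.fromBlocks_neg, Matrix.fromBlocks_add]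

theorem posSemidef_of_l2_opNorm_fromRows_le {A : Matrix m n 𝕜} {B : Matrix k n 𝕜} {c : ℝ}
    (h : ‖Matrix.fromRows A B‖ ≤ c) :
    ((c : 𝕜) ^ 2 • (1 : Matrix n n 𝕜) - Aᴴ * A - Bᴴ * B).PosSemidef := by
  have hc : 0 ≤ c := (norm_nonneg _).trans h
  rwa [l2_opNorm_le_iff_posSemidef _ hc, Matrix.conjTranspose_fromRows_eq_fromCols_conjTranspose,
    Matrix.fromCols_mul_fromRows, ← sub_sub] at h

theorem l2_opNorm_le_of_l2_opNorm_fromRows_le {A : Matrix m n 𝕜} {B : Matrix k n 𝕜} {c : ℝ}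
    (h : ‖Matrix.fromRows A B‖ ≤ c) : ‖A‖ ≤ c := by
  rw [l2_opNorm_le_iff_posSemidef _ ((norm_nonneg _).trans h)]
  simpa using (posSemidef_of_l2_opNorm_fromRows_le h).add
    (Matrix.posSemidef_conjTranspose_mul_self B)

end SpectralNorm

section SquareRoot

open scoped MatrixOrder ComplexOrder

theorem StructClass.posSemidef_adj (S : StructClass) {n : Type*} {A : Matrix n n 𝕜}
    (hA : A.PosSemidef) : (S.adj A).PosSemidef := by
  cases S
  exacts [hA.transpose, hA.transpose, hA.conjTranspose]

variable {m n : Type*} [Fintype m] [Fintype n]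

open scoped Classical in
theorem posSemidef_sqrt (A : Matrix n n 𝕜) : (CFC.sqrt A).PosSemidef :=
  Matrix.nonneg_iff_posSemidef.1 (CFC.sqrt_nonneg A)

open scoped Classical in
theorem sqrt_fromBlocks_diagonal {A : Matrix m m 𝕜} {D : Matrix n n 𝕜} (hA : A.PosSemidef)
    (hD : D.PosSemidef) : CFC.sqrt (Matrix.fromBlocks A 0 0 D) =
      Matrix.fromBlocks (CFC.sqrt A) 0 0 (CFC.sqrt D) := by
  refine CFC.sqrt_unique ?_
    (posSemidef_fromBlocks_diagonal (posSemidef_sqrt A) (posSemidef_sqrt D)).nonneg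
  simp [Matrix.fromBlocks_multiply, CFC.sqrt_mul_sqrt_self _ hA.nonneg,
    CFC.sqrt_mul_sqrt_self _ hD.nonneg]

open scoped Classical in
/- Intertwining is commutation of the off-diagonal block matrix `[0, A; 0, 0]` with
`diag (Q, P)`. -/
theorem mul_sqrt_eq_sqrt_mul {A : Matrix m n 𝕜} {P : Matrix n n 𝕜} {Q : Matrix m m 𝕜}
    (hP : P.PosSemidef) (hQ : Q.PosSemidef) (h : A * P = Q * A) :
    A * CFC.sqrt P = CFC.sqrt Q * A := by
  have hcomm : Commute (Matrix.fromBlocks Q 0 0 P) (Matrix.fromBlocks 0 A 0 0) := by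
    simp [Commute, SemiconjBy, Matrix.fromBlocks_multiply, h]
  have hsqrt : Commute (CFC.sqrt (Matrix.fromBlocks Q 0 0 P)) (Matrix.fromBlocks 0 A 0 0) :=
    hcomm.cfcₙ_nnreal NNReal.sqrt
  rw [sqrt_fromBlocks_diagonal hQ hP, Commute, SemiconjBy, Matrix.fromBlocks_multiply,
    Matrix.fromBlocks_multiply] at hsqrt
  simpa using (Matrix.fromBlocks_inj.1 hsqrt).2.1.symm

open scoped Classical in
theorem StructClass.adj_sqrt (S : StructClass) {A : Matrix n n 𝕜} (hA : A.PosSemidef) :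
    S.adj (CFC.sqrt A) = CFC.sqrt (S.adj A) := by
  refine (CFC.sqrt_unique ?_ (S.posSemidef_adj (posSemidef_sqrt A)).nonneg).symm
  rw [← S.adj_mul, CFC.sqrt_mul_sqrt_self A hA.nonneg]

end SquareRoot

namespace StructClass

variable {l m n : Type*} (S : StructClass)

theorem signedAdj_conjTranspose (A : Matrix m n 𝕜) : S.signedAdj Aᴴ = (S.signedAdj A)ᴴ := by
  cases S <;> simp [signedAdj] <;> rfl

theorem adj_mul_conjTranspose_adj [Fintype n] (A : Matrix m n 𝕜) (B : Matrix l n 𝕜) :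
    (S.adj A)ᴴ * S.adj B = (S.signedAdj A)ᴴ * S.signedAdj B := by
  cases S <;> simp [adj, signedAdj]

end StructClass

section DefectOperator

open scoped Matrix.Norms.L2Operator MatrixOrder ComplexOrder

variable {m n : Type*} [Fintype m] [Fintype n] [DecidableEq m] [DecidableEq n]

/-- The defect operator `(μ² - AᴴA)^{1/2}` of a matrix `A` with spectral norm at most `μ`. -/
def defectOp (μ : ℝ) (A : Matrix m n 𝕜) : Matrix n n 𝕜 :=
  CFC.sqrt ((μ : 𝕜) ^ 2 • (1 : Matrix n n 𝕜) - Aᴴ * A)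

variable {μ : ℝ} {A : Matrix m n 𝕜}

omit [DecidableEq m] in
theorem conjTranspose_defectOp (μ : ℝ) (A : Matrix m n 𝕜) : (defectOp μ A)ᴴ = defectOp μ A :=
  (posSemidef_sqrt _).isHermitian

omit [DecidableEq m] in
theorem posSemidef_sub_gram (hA : ‖A‖ ≤ μ) :
    ((μ : 𝕜) ^ 2 • (1 : Matrix n n 𝕜) - Aᴴ * A).PosSemidef :=
  (l2_opNorm_le_iff_posSemidef A ((norm_nonneg A).trans hA)).1 hA

omit [DecidableEq m] in
theorem defectOp_mul_self (hA : ‖A‖ ≤ μ) :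
    defectOp μ A * defectOp μ A = (μ : 𝕜) ^ 2 • (1 : Matrix n n 𝕜) - Aᴴ * A :=
  CFC.sqrt_mul_sqrt_self _ (posSemidef_sub_gram hA).nonneg

theorem mul_defectOp (hA : ‖A‖ ≤ μ) : A * defectOp μ A = defectOp μ Aᴴ * A := by
  refine mul_sqrt_eq_sqrt_mul (posSemidef_sub_gram hA)
    (posSemidef_sub_gram (by rwa [Matrix.l2_opNorm_conjTranspose])) ?_
  simp [Matrix.mul_sub, Matrix.sub_mul, Matrix.mul_assoc]

theorem defectOp_mul_conjTranspose (hA : ‖A‖ ≤ μ) :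
    defectOp μ A * Aᴴ = Aᴴ * defectOp μ Aᴴ := by
  simpa using (mul_defectOp (A := Aᴴ) (by rwa [Matrix.l2_opNorm_conjTranspose])).symm

omit [DecidableEq m] in
theorem StructClass.adj_defectOp (S : StructClass) (hA : ‖A‖ ≤ μ) :
    S.adj (defectOp μ A) = defectOp μ (S.signedAdj A)ᴴ := by
  rw [defectOp, defectOp, S.adj_sqrt (posSemidef_sub_gram hA)]
  cases S <;> simp [adj, signedAdj] <;> rfl

end DefectOperator

section Dilation

open scoped Matrix.Norms.L2Operator ComplexOrder

variable {m n k l : Type*} [Fintype m] [Fintype n] [Fintype k] [Fintype l]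
  [DecidableEq m] [DecidableEq n] [DecidableEq k] [DecidableEq l]

/-- The Julia operator of `A`: `μ` times a unitary with upper left corner `A / μ`. -/
def juliaOp (μ : ℝ) (A : Matrix m n 𝕜) : Matrix (m ⊕ n) (n ⊕ m) 𝕜 :=
  Matrix.fromBlocks A (defectOp μ Aᴴ) (defectOp μ A) (-Aᴴ)

/-- The lower right corner, with parameter `Z`, which completes a first block column `(A, K D)` and
a first block row `(A, D' L)` to a matrix of norm at most `μ`, where `D` and `D'` are the defect
operators of `A` and `Aᴴ`. -/
def dilationCorner (μ : ℝ) (A : Matrix m n 𝕜) (K : Matrix k n 𝕜) (L : Matrix m l 𝕜)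
    (Z : Matrix k l 𝕜) : Matrix k l 𝕜 :=
  -(K * Aᴴ * L) + (μ : 𝕜) • (defectOp 1 Kᴴ * Z * defectOp 1 L)

variable {μ : ℝ} {A : Matrix m n 𝕜} {K : Matrix k n 𝕜} {L : Matrix m l 𝕜} {Z : Matrix k l 𝕜}

theorem l2_opNorm_juliaOp_le (hA : ‖A‖ ≤ μ) : ‖juliaOp μ A‖ ≤ μ := by
  refine l2_opNorm_le_of_conjTranspose_mul_self ((norm_nonneg A).trans hA) ?_
  have hAH : ‖Aᴴ‖ ≤ μ := by rwa [Matrix.l2_opNorm_conjTranspose]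
  rw [juliaOp, Matrix.fromBlocks_conjTranspose, Matrix.fromBlocks_multiply]
  simp [conjTranspose_defectOp, defectOp_mul_self hA, defectOp_mul_self hAH, mul_defectOp hA,
    defectOp_mul_conjTranspose hA, ← Matrix.fromBlocks_one, Matrix.fromBlocks_smul]

theorem l2_opNorm_contraction_row_le (hK : ‖K‖ ≤ 1) :
    ‖Matrix.fromCols (Matrix.fromBlocks (1 : Matrix m m 𝕜) 0 0 K)
      (Matrix.fromRows 0 (defectOp 1 Kᴴ))‖ ≤ 1 := by
  have hKH : ‖Kᴴ‖ ≤ 1 := by rwa [Matrix.l2_opNorm_conjTranspose]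
  apply l2_opNorm_le_one_of_isStarProjection
  rw [Matrix.conjTranspose_fromCols_eq_fromRows_conjTranspose, Matrix.fromCols_mul_fromRows,
    Matrix.fromBlocks_conjTranspose, Matrix.fromBlocks_multiply,
    Matrix.conjTranspose_fromRows_eq_fromCols_conjTranspose, Matrix.fromRows_mul_fromCols,
    Matrix.fromBlocks_add, conjTranspose_defectOp, defectOp_mul_self hKH]
  simp [IsStarProjection.one]

omit [DecidableEq m] in
theorem l2_opNorm_contraction_col_le (hL : ‖L‖ ≤ 1) :
    ‖Matrix.fromRows (Matrix.fromBlocks (1 : Matrix n n 𝕜) 0 0 L)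
      (Matrix.fromCols 0 (defectOp 1 L))‖ ≤ 1 := by
  classical
  have h := l2_opNorm_contraction_row_le (m := n) (K := Lᴴ)
    (by rwa [Matrix.l2_opNorm_conjTranspose])
  rw [← Matrix.l2_opNorm_conjTranspose] at h
  simpa [Matrix.conjTranspose_fromCols_eq_fromRows_conjTranspose, Matrix.fromBlocks_conjTranspose,
    Matrix.conjTranspose_fromRows_eq_fromCols_conjTranspose, conjTranspose_defectOp] using h

/- The matrix is the compression of `diag (J, μ Z)`, with `J` the Julia operator of `A`, by the
contractions `[1, 0, 0; 0, K, (1 - K Kᴴ)^{1/2}]` and `[1, 0; 0, L; 0, (1 - Lᴴ L)^{1/2}]`. -/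
theorem l2_opNorm_dilation_le (hA : ‖A‖ ≤ μ) (hK : ‖K‖ ≤ 1) (hL : ‖L‖ ≤ 1) (hZ : ‖Z‖ ≤ 1) :
    ‖Matrix.fromBlocks A (defectOp μ Aᴴ * L) (K * defectOp μ A)
      (dilationCorner μ A K L Z)‖ ≤ μ := by
  have hμ : 0 ≤ μ := (norm_nonneg A).trans hA
  have hfactor : Matrix.fromBlocks A (defectOp μ Aᴴ * L) (K * defectOp μ A)
      (dilationCorner μ A K L Z) =
      Matrix.fromCols (Matrix.fromBlocks (1 : Matrix m m 𝕜) 0 0 K)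
          (Matrix.fromRows 0 (defectOp 1 Kᴴ)) *
        Matrix.fromBlocks (juliaOp μ A) 0 0 ((μ : 𝕜) • Z) *
        Matrix.fromRows (Matrix.fromBlocks (1 : Matrix n n 𝕜) 0 0 L)
          (Matrix.fromCols 0 (defectOp 1 L)) := by
    rw [Matrix.fromCols_mul_fromBlocks, Matrix.fromCols_mul_fromRows, juliaOp]
    ext (i | i) (j | j) <;>
      simp [Matrix.fromBlocks_multiply, Matrix.fromRows_mul, dilationCorner]
  have hmid : ‖Matrix.fromBlocks (juliaOp μ A) 0 0 ((μ : 𝕜) • Z)‖ ≤ μ := by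
    apply l2_opNorm_fromBlocks_diagonal_le (l2_opNorm_juliaOp_le hA)
    rw [norm_smul, RCLike.norm_ofReal, abs_of_nonneg hμ]
    exact mul_le_of_le_one_right hμ hZ
  rw [hfactor]
  calc _ ≤ 1 * μ * 1 := by
        refine (Matrix.l2_opNorm_mul _ _).trans ?_
        gcongr
        · refine (Matrix.l2_opNorm_mul _ _).trans ?_
          gcongr
          exact l2_opNorm_contraction_row_le hK
        · exact l2_opNorm_contraction_col_le hL
    _ = μ := by ring

end Dilation

section RangeInclusion

open scoped Matrix.Norms.L2Operator ComplexOrder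

variable {r q : ℕ} {M : Matrix (Fin r) (Fin r) 𝕜} {b : Matrix (Fin q) (Fin r) 𝕜}

theorem mul_eq_zero_of_gram_le {m : Type*} [Finite m] {E : Matrix (Fin r) m 𝕜}
    (h : (M * M - bᴴ * b).PosSemidef) (hE : M * E = 0) : b * E = 0 := by
  have := Fintype.ofFinite m
  have hgram : Eᴴ * (M * M - bᴴ * b) * E = -((b * E)ᴴ * (b * E)) := by
    simp [Matrix.mul_sub, Matrix.sub_mul, Matrix.mul_assoc, hE]
  have hneg := (h.conjTranspose_mul_mul_same E).trace_nonneg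
  have hpos := (Matrix.posSemidef_conjTranspose_mul_self (b * E)).trace_nonneg
  rw [hgram, Matrix.trace_neg, neg_nonneg] at hneg
  exact Matrix.trace_conjTranspose_mul_self_eq_zero_iff.1 (hneg.antisymm hpos)

theorem mul_pinv_mul_self_of_gram_le (h : (M * M - bᴴ * b).PosSemidef) :
    b * pinv M * M = b := by
  have hE : b * (1 - pinv M * M) = 0 := by
    apply mul_eq_zero_of_gram_le h
    rw [Matrix.mul_sub, Matrix.mul_one, ← Matrix.mul_assoc, (pinv_spec M).mul_mul_self, sub_self]
  rw [Matrix.mul_sub, Matrix.mul_one, sub_eq_zero] at hE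
  rw [Matrix.mul_assoc, ← hE]

theorem l2_opNorm_mul_pinv_le_one (hM : Mᴴ = M) (h : (M * M - bᴴ * b).PosSemidef) :
    ‖b * pinv M‖ ≤ 1 := by
  have hgram : (M * pinv M)ᴴ * (M * pinv M) - (b * pinv M)ᴴ * (b * pinv M) =
      (pinv M)ᴴ * (M * M - bᴴ * b) * pinv M := by
    simp only [Matrix.conjTranspose_mul, Matrix.mul_sub, Matrix.sub_mul, Matrix.mul_assoc, hM]
  have hproj := (l2_opNorm_le_iff_posSemidef _ zero_le_one).1 (isStarProjection_mul_pinv M).norm_le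
  rw [l2_opNorm_le_iff_posSemidef _ zero_le_one]
  simpa [← hgram] using hproj.add (h.conjTranspose_mul_mul_same (pinv M))

variable {μ : ℝ} {a : Matrix (Fin r) (Fin r) 𝕜}

theorem posSemidef_defectOp_sq_sub_gram (hab : ‖Matrix.fromRows a b‖ ≤ μ) :
    (defectOp μ a * defectOp μ a - bᴴ * b).PosSemidef := by
  rw [defectOp_mul_self (l2_opNorm_le_of_l2_opNorm_fromRows_le hab)]
  exact posSemidef_of_l2_opNorm_fromRows_le hab

theorem mul_pinv_defectOp_mul_defectOp (hab : ‖Matrix.fromRows a b‖ ≤ μ) :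
    b * pinv (defectOp μ a) * defectOp μ a = b :=
  mul_pinv_mul_self_of_gram_le (posSemidef_defectOp_sq_sub_gram hab)

theorem l2_opNorm_mul_pinv_defectOp_le_one (hab : ‖Matrix.fromRows a b‖ ≤ μ) :
    ‖b * pinv (defectOp μ a)‖ ≤ 1 :=
  l2_opNorm_mul_pinv_le_one (conjTranspose_defectOp μ a) (posSemidef_defectOp_sq_sub_gram hab)

end RangeInclusion

section StructuredDilation

open scoped Matrix.Norms.L2Operator ComplexOrder

namespace StructClass

theorem signedAdj_signedAdj {m n : Type*} (S : StructClass) (A : Matrix m n 𝕜) :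
    S.signedAdj (S.signedAdj A) = A := by
  cases S <;> simp [signedAdj]

theorem l2_opNorm_adj_le {m n : Type*} [Fintype m] [Fintype n] [DecidableEq m] [DecidableEq n]
    (S : StructClass) {A : Matrix m n 𝕜} {c : ℝ} (hA : ‖A‖ ≤ c) : ‖S.adj A‖ ≤ c := by
  have hAH : ‖Aᴴ‖ ≤ c := by rwa [Matrix.l2_opNorm_conjTranspose]
  have h := S.posSemidef_adj (posSemidef_sub_gram hAH)
  rw [l2_opNorm_le_iff_posSemidef _ ((norm_nonneg A).trans hA)]
  convert h using 1
  cases S <;> simp [adj] <;> rfl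

theorem l2_opNorm_signedAdj_le {m n : Type*} [Fintype m] [Fintype n] [DecidableEq m]
    [DecidableEq n] (S : StructClass) {A : Matrix m n 𝕜} {c : ℝ} (hA : ‖A‖ ≤ c) :
    ‖S.signedAdj A‖ ≤ c := by
  have h := S.l2_opNorm_adj_le hA
  cases S <;> simpa [adj, signedAdj] using h

variable {S : StructClass} {j k : ℕ}

theorem conjTranspose_mem_matrices {C : Matrix (Fin k) (Fin k) 𝕜} (hC : C ∈ S.matrices 𝕜 k) :
    Cᴴ ∈ S.matrices 𝕜 k := by
  rw [mem_matrices_iff] at *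
  rw [signedAdj_conjTranspose, hC]

theorem mul_mul_signedAdj_mem_matrices {C : Matrix (Fin j) (Fin j) 𝕜} (hC : C ∈ S.matrices 𝕜 j)
    (K : Matrix (Fin k) (Fin j) 𝕜) : K * C * S.signedAdj K ∈ S.matrices 𝕜 k := by
  cases S <;> simp_all [matrices, signedAdj, Matrix.mul_assoc]

end StructClass

variable {S : StructClass} {r q : ℕ} {μ : ℝ} {a : Matrix (Fin r) (Fin r) 𝕜}
  {b K : Matrix (Fin q) (Fin r) 𝕜} {Z : Matrix (Fin q) (Fin q) 𝕜}

theorem dilationCorner_mem_matrices (ha : a ∈ S.matrices 𝕜 r) (hK : ‖K‖ ≤ 1)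
    (hZ : Z ∈ S.matrices 𝕜 q) : dilationCorner μ a K (S.signedAdj K) Z ∈ S.matrices 𝕜 q := by
  have hK' := S.l2_opNorm_signedAdj_le hK
  have hdefect : S.adj (defectOp 1 (S.signedAdj K)) = defectOp 1 Kᴴ := by
    rw [S.adj_defectOp hK', S.signedAdj_signedAdj]
  have hfree := StructClass.adj_mul_mul_mem_matrices hZ (defectOp 1 (S.signedAdj K))
  rw [hdefect] at hfree
  rw [dilationCorner, ← RCLike.real_smul_eq_coe_smul]
  exact (S.realSubspace 𝕜 q).add_mem
    ((S.realSubspace 𝕜 q).neg_mem (StructClass.mul_mul_signedAdj_mem_matrices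
      (StructClass.conjTranspose_mem_matrices ha) K))
    ((S.realSubspace 𝕜 q).smul_mem μ hfree)

theorem l2_opNorm_structured_dilation_le (ha : a ∈ S.matrices 𝕜 r)
    (hab : ‖Matrix.fromRows a b‖ ≤ μ) (hK : K = b * pinv (defectOp μ a)) (hZ : ‖Z‖ ≤ 1) :
    ‖Matrix.fromBlocks a (S.signedAdj b) b (dilationCorner μ a K (S.signedAdj K) Z)‖ ≤ μ := by
  have ha_norm := l2_opNorm_le_of_l2_opNorm_fromRows_le hab
  have hb : K * defectOp μ a = b := hK ▸ mul_pinv_defectOp_mul_defectOp hab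
  have hσb : defectOp μ aᴴ * S.signedAdj K = S.signedAdj b := by
    rw [← hb, S.signedAdj_mul_right, S.adj_defectOp ha_norm, S.mem_matrices_iff.1 ha]
  have hK_norm : ‖K‖ ≤ 1 := hK ▸ l2_opNorm_mul_pinv_defectOp_le_one hab
  rw [← hσb, ← hb]
  simpa only [hb] using
    l2_opNorm_dilation_le ha_norm hK_norm (S.l2_opNorm_signedAdj_le hK_norm) hZ

end StructuredDilation

section AdaptedFrame

open scoped Matrix.Norms.L2Operator

/-- The partition `[U₁ U₂]` of the left factor of a singular value decomposition of `X`, as far as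
it matters: the columns of `U₁` and `U₂` are Parseval frames of the column space of `X` and of its
orthogonal complement. Linear independence of the columns is not required, so that `U₁ = X X†` and
`U₂ = 1 - X X†` are allowed. -/
structure IsAdaptedFrame {n p r q : ℕ} (X : Matrix (Fin n) (Fin p) 𝕜)
    (U₁ : Matrix (Fin n) (Fin r) 𝕜) (U₂ : Matrix (Fin n) (Fin q) 𝕜) : Prop where
  left_mul_conjTranspose : U₁ * U₁ᴴ = X * pinv X
  right_mul_conjTranspose : U₂ * U₂ᴴ = 1 - X * pinv X

theorem isAdaptedFrame_mul_pinv {n p : ℕ} (X : Matrix (Fin n) (Fin p) 𝕜) :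
    IsAdaptedFrame X (X * pinv X) (1 - X * pinv X) where
  left_mul_conjTranspose := by
    have h := isStarProjection_mul_pinv X
    rw [h.isSelfAdjoint.isHermitian.eq, h.isIdempotentElem.eq]
  right_mul_conjTranspose := by
    have h := (isStarProjection_mul_pinv X).one_sub
    rw [h.isSelfAdjoint.isHermitian.eq, h.isIdempotentElem.eq]

namespace IsAdaptedFrame

variable {n p r q : ℕ} {X : Matrix (Fin n) (Fin p) 𝕜} {U₁ : Matrix (Fin n) (Fin r) 𝕜}
  {U₂ : Matrix (Fin n) (Fin q) 𝕜}

open scoped ComplexOrder in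
theorem mul_pinv_mul_left (h : IsAdaptedFrame X U₁ U₂) : X * pinv X * U₁ = U₁ := by
  have h0 : (1 - X * pinv X) * (U₁ * U₁ᴴ) = 0 := by
    rw [h.left_mul_conjTranspose, ← Matrix.mul_assoc, one_sub_mul_pinv_mul_self, Matrix.zero_mul]
  rw [Matrix.mul_self_mul_conjTranspose_eq_zero, Matrix.sub_mul, Matrix.one_mul, sub_eq_zero] at h0
  exact h0.symm

open scoped ComplexOrder in
theorem conjTranspose_right_mul (h : IsAdaptedFrame X U₁ U₂) : U₂ᴴ * X = 0 := by
  rw [← Matrix.self_mul_conjTranspose_mul_eq_zero, h.right_mul_conjTranspose,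
    one_sub_mul_pinv_mul_self]

theorem fromCols_mul_conjTranspose (h : IsAdaptedFrame X U₁ U₂) :
    Matrix.fromCols U₁ U₂ * (Matrix.fromCols U₁ U₂)ᴴ = 1 := by
  rw [Matrix.conjTranspose_fromCols_eq_fromRows_conjTranspose, Matrix.fromCols_mul_fromRows,
    h.left_mul_conjTranspose, h.right_mul_conjTranspose, add_sub_cancel]

theorem l2_opNorm_fromCols_le_one (h : IsAdaptedFrame X U₁ U₂) :
    ‖Matrix.fromCols U₁ U₂‖ ≤ 1 := by
  apply l2_opNorm_le_one_of_isStarProjection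
  rw [h.fromCols_mul_conjTranspose]
  exact IsStarProjection.one _

theorem l2_opNorm_left_le_one (h : IsAdaptedFrame X U₁ U₂) : ‖U₁‖ ≤ 1 := by
  apply l2_opNorm_le_one_of_isStarProjection
  rw [h.left_mul_conjTranspose]
  exact isStarProjection_mul_pinv X

end IsAdaptedFrame

end AdaptedFrame

section SpectralSolutions

open scoped Matrix.Norms.L2Operator

theorem StructClass.adj_fromCols {m n₁ n₂ : Type*} (S : StructClass) (A : Matrix m n₁ 𝕜)
    (B : Matrix m n₂ 𝕜) :
    S.adj (Matrix.fromCols A B) = Matrix.fromRows (S.adj A) (S.adj B) := by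
  cases S
  exacts [Matrix.transpose_fromCols A B, Matrix.transpose_fromCols A B,
    Matrix.conjTranspose_fromCols_eq_fromRows_conjTranspose A B]

theorem StructClass.l2_opNorm_adj_mul_mul_le {m n : Type*} [Fintype m] [Fintype n] [DecidableEq m]
    [DecidableEq n] (S : StructClass) {M : Matrix m m 𝕜} {W : Matrix m n 𝕜} {c : ℝ}
    (hM : ‖M‖ ≤ c) (hW : ‖W‖ ≤ 1) : ‖S.adj W * M * W‖ ≤ c := by
  have hc : 0 ≤ c := (norm_nonneg M).trans hM
  calc ‖S.adj W * M * W‖ ≤ ‖S.adj W‖ * ‖M‖ * ‖W‖ := by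
        refine (Matrix.l2_opNorm_mul _ _).trans ?_
        exact mul_le_mul_of_nonneg_right (Matrix.l2_opNorm_mul _ _) (norm_nonneg W)
    _ ≤ 1 * c * 1 := by
        gcongr
        exact S.l2_opNorm_adj_le hW
    _ = c := by ring

variable {n p r q : ℕ} {S : StructClass} {X B : Matrix (Fin n) (Fin p) 𝕜}
  {U₁ : Matrix (Fin n) (Fin r) 𝕜} {U₂ : Matrix (Fin n) (Fin q) 𝕜}
  {A : Matrix (Fin n) (Fin n) 𝕜} {Z : Matrix (Fin q) (Fin q) 𝕜}

theorem mul_pinv_mul_left (hA : A * X = B) (hU : IsAdaptedFrame X U₁ U₂) :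
    B * pinv X * U₁ = A * U₁ := by
  rw [mul_pinv_of_mul_eq hA, Matrix.mul_assoc, hU.mul_pinv_mul_left]

theorem l2_opNorm_first_block_column_le (S : StructClass) (hA : A * X = B)
    (hU : IsAdaptedFrame X U₁ U₂) :
    ‖Matrix.fromRows (S.adj U₁ * A * U₁) (S.adj U₂ * A * U₁)‖ ≤ specNorm (B * pinv X) := by
  rw [← Matrix.fromRows_mul, ← Matrix.fromRows_mul, ← S.adj_fromCols, Matrix.mul_assoc,
    ← mul_pinv_mul_left hA hU]
  calc _ ≤ 1 * (specNorm (B * pinv X) * 1) := by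
        refine (Matrix.l2_opNorm_mul _ _).trans ?_
        gcongr
        · exact S.l2_opNorm_adj_le hU.l2_opNorm_fromCols_le_one
        · refine (Matrix.l2_opNorm_mul _ _).trans ?_
          exact mul_le_mul_of_nonneg_left hU.l2_opNorm_left_le_one (norm_nonneg _)
    _ = specNorm (B * pinv X) := by ring

theorem solMap_add_eq_mul_fromBlocks_mul (hA : A ∈ solutions (S.matrices 𝕜 n) X B)
    (hU : IsAdaptedFrame X U₁ U₂) (D : Matrix (Fin q) (Fin q) 𝕜) :
    solMap S X B + S.adj U₂ᴴ * D * U₂ᴴ = S.adj (Matrix.fromCols U₁ U₂)ᴴ *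
      Matrix.fromBlocks (S.adj U₁ * A * U₁) (S.signedAdj (S.adj U₂ * A * U₁))
        (S.adj U₂ * A * U₁) D * (Matrix.fromCols U₁ U₂)ᴴ := by
  set P := X * pinv X with hP
  have hb : S.signedAdj (S.adj U₂ * A * U₁) = S.adj U₁ * A * U₂ := by
    rw [S.signedAdj_mul_right, S.signedAdj_mul_left, S.mem_matrices_iff.1 hA.1, S.adj_adj,
      Matrix.mul_assoc]
  rw [hb, S.adj_conjTranspose (Matrix.fromCols U₁ U₂), S.adj_fromCols,
    Matrix.conjTranspose_fromRows_eq_fromCols_conjTranspose,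
    Matrix.conjTranspose_fromCols_eq_fromRows_conjTranspose, Matrix.fromCols_mul_fromBlocks,
    Matrix.fromCols_mul_fromRows]
  calc _ = S.adj P * A * P + S.adj P * A * (1 - P) + S.adj (1 - P) * A * P
        + S.adj U₂ᴴ * D * U₂ᴴ := by
        rw [solMap_eq_sub hA, S.adj_sub, S.adj_one]
        noncomm_ring
    _ = _ := by
        rw [hP, ← hU.right_mul_conjTranspose, ← hU.left_mul_conjTranspose]
        simp only [S.adj_mul, S.adj_conjTranspose, Matrix.add_mul, Matrix.mul_assoc]
        abel

theorem dilK_eq (hA : A ∈ solutions (S.matrices 𝕜 n) X B) (hU : IsAdaptedFrame X U₁ U₂) :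
    dilK S X B U₁ = A * U₁ * pinv (defectOp (specNorm (B * pinv X)) (S.adj U₁ * A * U₁)) := by
  have hgram : U₁ᴴ * (S.signedAdj (B * pinv X))ᴴ * (B * pinv X * U₁) =
      (S.adj U₁ * A * U₁)ᴴ * (S.adj U₁ * A * U₁) := by
    have hP : S.adj (X * pinv X) = (S.adj U₁)ᴴ * S.adj U₁ := by
      rw [← hU.left_mul_conjTranspose, S.adj_mul, S.adj_conjTranspose]
    rw [mul_pinv_mul_left hA.2 hU, mul_pinv_of_mul_eq hA.2, S.signedAdj_mul_right,
      S.mem_matrices_iff.1 hA.1, hP]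
    simp only [Matrix.conjTranspose_mul, Matrix.conjTranspose_conjTranspose, Matrix.mul_assoc]
  rw [← mul_pinv_mul_left hA.2 hU, defectOp, ← hgram]
  unfold dilK
  generalize B * pinv X = G
  cases S <;> simp [psdInvSqrt, psdSqrt, StructClass.signedAdj, Matrix.mul_assoc] <;> rfl

theorem adj_mul_dilK_eq (hA : A ∈ solutions (S.matrices 𝕜 n) X B) (hU : IsAdaptedFrame X U₁ U₂) :
    S.adj U₂ * dilK S X B U₁ = S.adj U₂ * A * U₁ *
      pinv (defectOp (specNorm (B * pinv X)) (S.adj U₁ * A * U₁)) := by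
  rw [dilK_eq hA hU]
  simp only [Matrix.mul_assoc]

theorem dilSol_eq (S : StructClass) (X B : Matrix (Fin n) (Fin p) 𝕜)
    (U₁ : Matrix (Fin n) (Fin r) 𝕜) (U₂ : Matrix (Fin n) (Fin q) 𝕜)
    (Z : Matrix (Fin q) (Fin q) 𝕜) :
    dilSol S X B U₁ U₂ Z = solMap S X B
      - S.adj (1 - X * pinv X) * dilK S X B U₁ * U₁ᴴ * (S.adj (B * pinv X * U₁))ᴴ *
          S.adj (dilK S X B U₁) * (1 - X * pinv X)
      + ((specNorm (B * pinv X) : ℝ) : 𝕜) • (S.adj U₂ᴴ *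
          psdSqrt (1 - S.adj U₂ * dilK S X B U₁ * (dilK S X B U₁)ᴴ * S.adj U₂ᴴ) * Z *
          psdSqrt (1 - U₂ᴴ * (S.adj (dilK S X B U₁))ᴴ * S.adj (dilK S X B U₁) * U₂) * U₂ᴴ) := by
  have hQ := (isStarProjection_mul_pinv X).one_sub.isSelfAdjoint.isHermitian.eq
  cases S
  · rfl
  · rfl
  · simp [dilSol, StructClass.adj, hQ]

theorem dilSol_eq_add (hA : A ∈ solutions (S.matrices 𝕜 n) X B) (hU : IsAdaptedFrame X U₁ U₂) :
    dilSol S X B U₁ U₂ Z = solMap S X B + S.adj U₂ᴴ *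
      dilationCorner (specNorm (B * pinv X)) (S.adj U₁ * A * U₁) (S.adj U₂ * dilK S X B U₁)
        (S.signedAdj (S.adj U₂ * dilK S X B U₁)) Z * U₂ᴴ := by
  have hQ := hU.right_mul_conjTranspose
  rw [dilSol_eq, ← hQ, mul_pinv_mul_left hA.2 hU]
  generalize dilK S X B U₁ = K
  set K₂ := S.adj U₂ * K with hK₂
  have hadj : S.adj K₂ = S.adj K * U₂ := by rw [hK₂, S.adj_mul, S.adj_adj]
  have hcorner : (S.adj U₁ * A * U₁)ᴴ * S.signedAdj K₂ =
      U₁ᴴ * (S.adj (A * U₁))ᴴ * S.adj K * U₂ := by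
    have ha := S.mem_matrices_iff.1 (StructClass.adj_mul_mul_mem_matrices hA.1 U₁)
    rw [← ha, ← S.adj_mul_conjTranspose_adj, hadj, Matrix.mul_assoc (S.adj U₁), S.adj_mul,
      S.adj_adj, Matrix.conjTranspose_mul, ← Matrix.mul_assoc]
  have hleft : defectOp 1 K₂ᴴ = psdSqrt (1 - S.adj U₂ * K * Kᴴ * S.adj U₂ᴴ) := by
    simp [defectOp, psdSqrt, hK₂, S.adj_conjTranspose, Matrix.mul_assoc]
  have hright : defectOp 1 (S.signedAdj K₂) =
      psdSqrt (1 - U₂ᴴ * (S.adj K)ᴴ * S.adj K * U₂) := by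
    rw [defectOp, psdSqrt, ← S.adj_mul_conjTranspose_adj, hadj]
    simp [Matrix.mul_assoc]
  rw [dilationCorner, Matrix.mul_assoc K₂ (S.adj U₁ * A * U₁)ᴴ, hcorner, hleft, hright, S.adj_mul]
  simp only [hK₂, Matrix.mul_add, Matrix.add_mul, Matrix.mul_neg, Matrix.neg_mul, Matrix.mul_smul,
    Matrix.smul_mul, Matrix.mul_assoc, sub_eq_add_neg, add_assoc]

theorem dilSol_mem_solutions (hA : A ∈ solutions (S.matrices 𝕜 n) X B)
    (hU : IsAdaptedFrame X U₁ U₂) (hZ : Z ∈ S.matrices 𝕜 q) :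
    dilSol S X B U₁ U₂ Z ∈ solutions (S.matrices 𝕜 n) X B := by
  have hK : ‖S.adj U₂ * dilK S X B U₁‖ ≤ 1 := by
    rw [adj_mul_dilK_eq hA hU]
    exact l2_opNorm_mul_pinv_defectOp_le_one (l2_opNorm_first_block_column_le S hA.2 hU)
  rw [dilSol_eq_add hA hU]
  refine add_mem_solutions (solMap_mem_solutions ⟨A, hA⟩) ?_ ?_
  · exact StructClass.adj_mul_mul_mem_matrices (dilationCorner_mem_matrices
      (StructClass.adj_mul_mul_mem_matrices hA.1 U₁) hK hZ) U₂ᴴ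
  · rw [Matrix.mul_assoc, hU.conjTranspose_right_mul, Matrix.mul_zero]

theorem specNorm_dilSol_le (hA : A ∈ solutions (S.matrices 𝕜 n) X B)
    (hU : IsAdaptedFrame X U₁ U₂) (hZ : specNorm Z ≤ 1) :
    specNorm (dilSol S X B U₁ U₂ Z) ≤ specNorm (B * pinv X) := by
  have hW : ‖(Matrix.fromCols U₁ U₂)ᴴ‖ ≤ 1 := by
    rw [Matrix.l2_opNorm_conjTranspose]
    exact hU.l2_opNorm_fromCols_le_one
  rw [dilSol_eq_add hA hU, solMap_add_eq_mul_fromBlocks_mul hA hU]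
  refine S.l2_opNorm_adj_mul_mul_le ?_ hW
  exact l2_opNorm_structured_dilation_le (StructClass.adj_mul_mul_mem_matrices hA.1 U₁)
    (l2_opNorm_first_block_column_le S hA.2 hU) (adj_mul_dilK_eq hA hU) hZ

theorem specNorm_mul_pinv_le (hA : A * X = B) : specNorm (B * pinv X) ≤ specNorm A := by
  rw [mul_pinv_of_mul_eq hA]
  exact (Matrix.l2_opNorm_mul _ _).trans
    (mul_le_of_le_one_right (norm_nonneg _) (isStarProjection_mul_pinv X).norm_le)

theorem specNorm_dilSol (hA : A ∈ solutions (S.matrices 𝕜 n) X B)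
    (hU : IsAdaptedFrame X U₁ U₂) (hZ : Z ∈ S.matrices 𝕜 q) (hZ_norm : specNorm Z ≤ 1) :
    specNorm (dilSol S X B U₁ U₂ Z) = specNorm (B * pinv X) :=
  le_antisymm (specNorm_dilSol_le hA hU hZ_norm)
    (specNorm_mul_pinv_le (dilSol_mem_solutions hA hU hZ).2)

theorem sigma_specNorm (hne : (solutions (S.matrices 𝕜 n) X B).Nonempty) :
    sigma specNorm (S.matrices 𝕜 n) X B = specNorm (B * pinv X) := by
  obtain ⟨A, hA⟩ := hne
  -- `[X X†, 1 - X X†]` stands in for the left factor of a singular value decomposition.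
  have hU := isAdaptedFrame_mul_pinv X
  have h0 : (0 : Matrix (Fin n) (Fin n) 𝕜) ∈ S.matrices 𝕜 n := (S.realSubspace 𝕜 n).zero_mem
  have h0_norm : specNorm (0 : Matrix (Fin n) (Fin n) 𝕜) ≤ 1 := by simp [specNorm]
  refine IsLeast.csInf_eq
    ⟨⟨_, dilSol_mem_solutions hA hU h0, specNorm_dilSol hA hU h0 h0_norm⟩, ?_⟩
  rintro _ ⟨A, hA, rfl⟩
  exact specNorm_mul_pinv_le hA.2

theorem sigma_specNorm_univ (hA : A * X = B) :
    sigma specNorm Set.univ X B = specNorm (B * pinv X) := by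
  have hG : B * pinv X * X = B := by
    rw [← hA, Matrix.mul_assoc A, Matrix.mul_assoc, (pinv_spec X).mul_mul_self]
  refine IsLeast.csInf_eq ⟨⟨_, ⟨Set.mem_univ _, hG⟩, rfl⟩, ?_⟩
  rintro _ ⟨A, hA, rfl⟩
  exact specNorm_mul_pinv_le hA.2

end SpectralSolutions

section SVD

theorem eq_isStarProjection_of_mul_eq_of_rank_le {m : Type*} [Fintype m] {P Q : Matrix m m 𝕜}
    (hP : IsStarProjection P) (hQ : Q.IsHermitian) (hQP : Q * P = P) (hrank : Q.rank ≤ P.rank) :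
    Q = P := by
  classical
  have hle : LinearMap.range P.mulVecLin ≤ LinearMap.range Q.mulVecLin := by
    rintro _ ⟨v, rfl⟩
    exact ⟨P *ᵥ v, by simp [hQP]⟩
  have hrange := Submodule.eq_of_le_of_finrank_le hle hrank
  have hPQ : P * Q = Q := by
    apply Matrix.ext_of_mulVec_single
    intro i
    obtain ⟨w, hw⟩ : Q.mulVecLin (Pi.single i 1) ∈ LinearMap.range P.mulVecLin :=
      hrange ▸ ⟨_, rfl⟩
    simp only [Matrix.mulVecLin_apply] at hw
    rw [← Matrix.mulVec_mulVec, ← hw, Matrix.mulVec_mulVec, hP.isIdempotentElem.eq]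
  have hstar := congrArg Matrix.conjTranspose hQP
  rwa [Matrix.conjTranspose_mul, hP.isSelfAdjoint.isHermitian.eq, hQ.eq, hPQ] at hstar

variable {n p r : ℕ}

theorem lt_rank_of_antitone_diagonal {D : Matrix (Fin n) (Fin p) 𝕜} {s : ℕ → ℝ}
    (hs : Antitone s)
    (hD : ∀ (i : Fin n) (j : Fin p), D i j = if (i : ℕ) = (j : ℕ) then ((s i : ℝ) : 𝕜) else 0)
    {k : ℕ} (hkn : k < n) (hkp : k < p) (hk : 0 < s k) : k < D.rank := by
  have hsub : D.submatrix (Fin.castLE hkn) (Fin.castLE hkp) =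
      Matrix.diagonal fun t : Fin (k + 1) => ((s t : ℝ) : 𝕜) := by
    ext t t'
    simp [hD, Matrix.diagonal_apply, Fin.ext_iff]
  have hunit : IsUnit (Matrix.diagonal fun t : Fin (k + 1) => ((s t : ℝ) : 𝕜)) := by
    rw [Matrix.isUnit_iff_isUnit_det, Matrix.det_diagonal, isUnit_iff_ne_zero,
      Finset.prod_ne_zero_iff]
    intro t _
    rw [RCLike.ofReal_ne_zero]
    exact (hk.trans_le (hs (Nat.lt_succ_iff.1 t.2))).ne'
  have hle := Matrix.rank_submatrix_le D (Fin.castLE hkn) (Fin.castLE hkp)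
  rwa [hsub, Matrix.rank_of_isUnit _ hunit, Fintype.card_fin] at hle

theorem sum_eq_sum_first_add_sum_last {M : Type*} [AddCommMonoid M] (h : r ≤ n) (f : Fin n → M) :
    ∑ j, f j = ∑ j : Fin r, f ⟨j, lt_of_lt_of_le j.2 h⟩
      + ∑ j : Fin (n - r), f ⟨r + j, by have := j.2; omega⟩ := by
  rw [← (finCongr (Nat.add_sub_cancel' h)).sum_comp f, Fin.sum_univ_add]
  rfl

theorem firstCols_mul_add_lastCols_mul (h : r ≤ n) (U : Matrix (Fin n) (Fin n) 𝕜) :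
    firstCols h U * (firstCols h U)ᴴ + lastCols h U * (lastCols h U)ᴴ = U * Uᴴ := by
  ext i k
  rw [Matrix.mul_apply (M := U), sum_eq_sum_first_add_sum_last h]
  rfl

namespace IsSVD

variable {X Sig : Matrix (Fin n) (Fin p) 𝕜} {U : Matrix (Fin n) (Fin n) 𝕜}
  {V : Matrix (Fin p) (Fin p) 𝕜}

theorem rank_eq (h : IsSVD X U Sig V) : X.rank = Sig.rank := by
  have hU : IsUnit U.det := (Matrix.isUnit_iff_isUnit_det U).1
    (Unitary.isUnit_coe (U := ⟨U, h.unitary_left⟩))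
  have hV : IsUnit Vᴴ.det := (Matrix.isUnit_iff_isUnit_det Vᴴ).1
    (Unitary.isUnit_coe (U := star ⟨V, h.unitary_right⟩))
  rw [h.eq_mul, Matrix.rank_mul_eq_left_of_isUnit_det Vᴴ _ hV,
    Matrix.rank_mul_eq_right_of_isUnit_det U _ hU]

theorem apply_eq_zero (h : IsSVD X U Sig V) {i : Fin n} (hi : X.rank ≤ i) (j : Fin p) :
    Sig i j = 0 := by
  obtain ⟨s, hs_nonneg, hs, hSig⟩ := h.diag
  rw [hSig]
  split_ifs with hij
  · have hnot : ¬ 0 < s i := fun hpos =>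
      (lt_rank_of_antitone_diagonal hs hSig i.2 (hij ▸ j.2) hpos).not_ge (h.rank_eq ▸ hi)
    rw [le_antisymm (not_lt.1 hnot) (hs_nonneg i), RCLike.ofReal_zero]
  · rfl

theorem conjTranspose_lastCols_mul (h : IsSVD X U Sig V) :
    (lastCols (rank_le_rows X) U)ᴴ * X = 0 := by
  have hU : Uᴴ * U = 1 := Matrix.mem_unitaryGroup_iff'.1 h.unitary_left
  have hSig : (lastCols (rank_le_rows X) U)ᴴ * (U * Sig) = 0 := by
    ext j k
    have hrow : (Uᴴ * (U * Sig)) ⟨X.rank + j, by have := j.2; omega⟩ k = 0 := by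
      rw [← Matrix.mul_assoc, hU, Matrix.one_mul]
      exact h.apply_eq_zero (Nat.le_add_right _ _) k
    exact hrow
  calc _ = (lastCols (rank_le_rows X) U)ᴴ * (U * Sig * Vᴴ) := congrArg _ h.eq_mul
    _ = 0 := by rw [← Matrix.mul_assoc, hSig, Matrix.zero_mul]

theorem isAdaptedFrame (h : IsSVD X U Sig V) :
    IsAdaptedFrame X (firstCols (rank_le_rows X) U) (lastCols (rank_le_rows X) U) := by
  set U₁ := firstCols (rank_le_rows X) U
  set U₂ := lastCols (rank_le_rows X) U
  have hsum : U₁ * U₁ᴴ + U₂ * U₂ᴴ = 1 := by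
    rw [firstCols_mul_add_lastCols_mul]
    exact Matrix.mem_unitaryGroup_iff.1 h.unitary_left
  have hX : U₁ * U₁ᴴ * X = X := by
    rw [eq_sub_of_add_eq hsum, Matrix.sub_mul, Matrix.one_mul, Matrix.mul_assoc,
      h.conjTranspose_lastCols_mul, Matrix.mul_zero, sub_zero]
  have hrank : (U₁ * U₁ᴴ).rank ≤ (X * pinv X).rank := by
    calc _ ≤ U₁.rank := Matrix.rank_mul_le_left _ _
      _ ≤ X.rank := by simpa using U₁.rank_le_card_width
      _ = (X * pinv X * X).rank := by rw [(pinv_spec X).mul_mul_self]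
      _ ≤ _ := Matrix.rank_mul_le_left _ _
  have hU₁ : U₁ * U₁ᴴ = X * pinv X := eq_isStarProjection_of_mul_eq_of_rank_le
    (isStarProjection_mul_pinv X) (Matrix.isHermitian_mul_conjTranspose_self U₁)
    (by rw [← Matrix.mul_assoc, hX]) hrank
  exact ⟨hU₁, by rw [← hU₁, ← hsum, add_sub_cancel_left]⟩

end IsSVD

end SVD

end StructMap

end

open StructMap in
theorem theorem3p5 {𝕜 : Type*} [RCLike 𝕜] {n p : ℕ} (S : StructClass)
    (X B : Matrix (Fin n) (Fin p) 𝕜) (hne : (solutions (S.matrices 𝕜 n) X B).Nonempty) :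
    -- all solutions
    (∀ A : Matrix (Fin n) (Fin n) 𝕜, A ∈ solutions (S.matrices 𝕜 n) X B ↔
      ∃ Z ∈ S.matrices 𝕜 n,
        A = solMap S X B + S.twist (1 - X * pinv X) * Z * (1 - X * pinv X)) ∧
    -- (a) Frobenius norm
    (solMap S X B ∈ solutions (S.matrices 𝕜 n) X B ∧
      sigma frobNorm (S.matrices 𝕜 n) X B = frobNorm (solMap S X B) ∧
      (∀ A ∈ solutions (S.matrices 𝕜 n) X B,
        frobNorm A = sigma frobNorm (S.matrices 𝕜 n) X B → A = solMap S X B) ∧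
      ∃ t : ℝ,
        (t : 𝕜) = (B * pinv X * (B * pinv X)ᴴ * S.twist (X * pinv X)).trace ∧
        0 ≤ 2 * frobNorm (B * pinv X) ^ 2 - t ∧
        frobNorm (solMap S X B) = Real.sqrt (2 * frobNorm (B * pinv X) ^ 2 - t)) ∧
    -- (b) spectral norm
    (sigma specNorm (S.matrices 𝕜 n) X B = specNorm (B * pinv X) ∧
      specNorm (B * pinv X) = sigma specNorm Set.univ X B ∧
      ∀ (U : Matrix (Fin n) (Fin n) 𝕜) (Sig : Matrix (Fin n) (Fin p) 𝕜)
        (V : Matrix (Fin p) (Fin p) 𝕜), IsSVD X U Sig V →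
        ∀ Z ∈ S.matrices 𝕜 (n - X.rank), specNorm Z ≤ 1 →
          dilSol S X B (firstCols (rank_le_rows X) U) (lastCols (rank_le_rows X) U) Z ∈
              solutions (S.matrices 𝕜 n) X B ∧
            specNorm (dilSol S X B (firstCols (rank_le_rows X) U)
              (lastCols (rank_le_rows X) U) Z) = sigma specNorm (S.matrices 𝕜 n) X B) := by
  obtain ⟨A₀, hA₀⟩ := id hne
  refine ⟨fun A => mem_solutions_iff_exists hne,
    ⟨solMap_mem_solutions hne, sigma_frobNorm hne,
      fun A hA h => eq_solMap_of_frobNorm_eq hA (h.trans (sigma_frobNorm hne)),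
      _, ofReal_frobNorm_adj_mul_sq S X B, ?_, ?_⟩,
    sigma_specNorm hne, (sigma_specNorm_univ hA₀.2).symm,
    fun U Sig V h Z hZ hZ_norm => ⟨dilSol_mem_solutions hA₀ h.isAdaptedFrame hZ, ?_⟩⟩
  · rw [← frobNorm_solMap_sq hne]
    exact sq_nonneg _
  · rw [← frobNorm_solMap_sq hne, Real.sqrt_sq (frobNorm_nonneg _)]
  · rw [sigma_specNorm hne]
    exact specNorm_dilSol hA₀ h.isAdaptedFrame hZ hZ_norm
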